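/- **Setting.** Let $1\le K<n$, $d,T\ge 0$ be integers, let $\ell_1,\dots,\ell_n:\mathbb{R}^d\to\mathbb{R}$ be convex and differentiable (the losses $\ell_i(\theta)=\ell(\theta;x_i,y_i)$ of the $n$ samples), and suppose that $f=\frac1n\sum_{i=1}^n\ell_i$ attains its minimum at $\theta^*$. Let $\alpha>0$, $\beta_1,\beta_2\in[0,1)$, $\lambda\in(0,1)$, $\epsilon>0$, $\gamma\in[0,1)$, $p_{\min}>0$, $L_0\ge 0$, $\theta_1\in\mathbb{R}^d$, and put $\alpha_t=\alpha/\sqrt t$, $\beta_{1,t}=\beta_1\lambda^{t-1}$. **Algorithm (AdamCB with unknown gradient bound).** Start with $m_0=v_0=\hat v_0=0$ and $w_{i,0}=1$ for $i\in[n]$. For $t=1,\dots,T$: 1. *Capping.* Let $C_0=(1/K-\gamma/n)/(1-\gamma)$. If $\max_i w_{i,t-1}<C_0\sum_i w_{i,t-1}$, let $S_{\mathrm{null},t}=\emptyset$ and $w'_i=w_{i,t-1}$. Otherwise let $\bar w_1\ge\dots\ge\bar w_n$ be the sorted weights, let $k\ge0$ be the least index with $\bar w_{k+1}<\tau:=C_0\sum_{i>k}\bar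 w_i/(1-kC_0)$, and let $S_{\mathrm{null},t}=\{i:w_{i,t-1}\ge\tau\}$, $w'_i=\tau$ for $i\in S_{\mathrm{null},t}$ and $w'_i=w_{i,t-1}$ for the other $i$. 2. *Sampling.* Let $p_{i,t}=K\big((1-\gamma)\,w'_i/\sum_j w'_j+\gamma/n\big)$, so that $\sum_i p_{i,t}=K$, and draw $J_t\subseteq[n]$ by dependent rounding: start with $p=(p_{i,t})_i$ and, as long as $p$ has an entry in $(0,1)$, choose $i\ne j$ with $p_i,p_j\in(0,1)$ (by any fixed rule that depends on $p$), put $a=\min\{1-p_i,p_j\}$, $b=\min\{p_i,1-p_j\}$, and replace $(p_i,p_j)$ by $(p_i+a,p_j-a)$ with probability $b/(a+b)$ and by $(p_i-b,p_j+b)$ with probability $a/(a+b)$; at the end $J_t=\{i:p_i=1\}$. 3. *Moments and step.* With $g_{i,t}=\nabla\ell_i(\theta_t)$ and the unbiased estimate $g_t=\frac1K\sum_{j\in J_t}\frac{g_{j,t}}{n\,(p_{j,t}/K)}$ let, coordinatewise, $m_t=\beta_{1,t}m_{t-1}+(1-\beta_{1,t})g_t$, $v_t=\beta_2v_{t-1}+(1-\beta_2)g_t^2$,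 $\hat v_1=v_1$, $\hat v_t=\max\big\{\tfrac{(1-\beta_{1,t})^2}{(1-\beta_{1,t-1})^2}\hat v_{t-1},v_t\big\}$ for $t\ge2$, and $\theta_{t+1}=\theta_t-\alpha_t\,m_t/(\sqrt{\hat v_t}+\epsilon)$. 4. *Weights.* Let $L_t=\max(L_{t-1},\max_{j\in J_t}\|g_{j,t}\|)$ and $\ell_{j,t}=\frac{p_{\min}^2}{L_t^2}\Big(-\frac{\|g_{j,t}\|^2}{p_{j,t}^2}+\frac{L_t^2}{p_{\min}^2}\Big)$ for $j\in J_t$ (read as $0$ if $L_t=0$), $\ell_{j,t}=0$ for $j\notin J_t$; then $w_{j,t}=w_{j,t-1}\exp(-K\gamma\,\ell_{j,t}/n)$ for $j\notin S_{\mathrm{null},t}$ and $w_{j,t}=w_{j,t-1}$ for $j\in S_{\mathrm{null},t}$. **Theorem.** Let $L,D>0$. Suppose that almost surely $\|g_{i,t}\|\le L$ for all $i\in[n]$, $t\in[T]$, that almost surely $\|\theta_s-\theta_t\|\le D$ for all $s,t\in[T]$, and that $\|\theta_1-\theta^*\|\le D$. Then the cumulative regret $\mathcal R(T)=\mathbb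 E\big[\sum_{t=1}^T f(\theta_t)-T\min_\theta f(\theta)\big]$ satisfies $$\mathcal R(T)\le C\left(d\sqrt T+\frac{\sqrt d}{n^{3/4}}\Big(\frac TK\ln\frac nK\Big)^{1/4}\right),$$ where the constant $C>0$ depends only on $\alpha,\beta_1,\lambda,\beta_2,\epsilon,\gamma,L,D$; in particular $C$ does not depend on $d,n,K,T$, the losses, $\theta_1$, $p_{\min}$ or $L_0$. -/

import Mathlib

namespace AdamCB

open Finset

noncomputable section

/-- The parameter space `ℝ^d` with its Euclidean norm. -/
abbrev Vec (d : ℕ) := EuclideanSpace ℝ (Fin d)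

/-! ### Dependent rounding -/

/-- `q` is a fractional entry. -/
def IsFrac (q : ℝ) : Prop := 0 < q ∧ q < 1

/-- A way of carrying out the instruction "choose distinct `i, j` with `0 < p i < 1` and
`0 < p j < 1`" of dependent rounding. -/
structure PairRule (n : ℕ) where
  pick : (Fin n → ℝ) → Fin n × Fin n
  valid : ∀ p : Fin n → ℝ, (∃ i j, i ≠ j ∧ IsFrac (p i) ∧ IsFrac (p j)) →
    (pick p).1 ≠ (pick p).2 ∧ IsFrac (p (pick p).1) ∧ IsFrac (p (pick p).2)

/-- The vector `p` after its entries at `i` and `j` are replaced by `x` and `y`. -/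
def setPair {n : ℕ} (p : Fin n → ℝ) (i j : Fin n) (x y : ℝ) : Fin n → ℝ :=
  Function.update (Function.update p i x) j y

open Classical in
/-- The probability that dependent rounding, started from `p` and allowed `k` rounds of its
while-loop, returns the set `J`. -/
def depRoundAux {n : ℕ} (rule : PairRule n) :
    ℕ → (Fin n → ℝ) → Finset (Fin n) → ℝ
  | 0, p, J => if J = univ.filter (fun i => p i = 1) then 1 else 0
  | k + 1, p, J =>
    if ∃ i, IsFrac (p i) then
      let i := (rule.pick p).1
      let j := (rule.pick p).2
      let a := min (1 - p i) (p j)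
      let b := min (p i) (1 - p j)
      b / (a + b) * depRoundAux rule k (setPair p i j (p i + a) (p j - a)) J
        + a / (a + b) * depRoundAux rule k (setPair p i j (p i - b) (p j + b)) J
    else if J = univ.filter (fun i => p i = 1) then 1 else 0

/-- The probability that dependent rounding of `p` returns `J`. Every round makes at least one
more entry equal to `0` or `1`, so the loop stops after at most `n` rounds. -/
def depRound {n : ℕ} (rule : PairRule n) (p : Fin n → ℝ) (J : Finset (Fin n)) : ℝ :=
  depRoundAux rule n p J

/-! ### Batch selection -/

/-- `C = (1/K - γ/n) / (1 - γ)`. -/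
def capConst (n K : ℕ) (γ : ℝ) : ℝ := (1 / (K : ℝ) - γ / n) / (1 - γ)

/-- The threshold loop. It runs through the weights in descending order; `i` weights have been
removed so far and `S` is the sum of the remaining ones. It stops at the first remaining weight
that is below `τ = C S / (1 - i C)`. -/
def tauLoop (C : ℝ) : ℕ → ℝ → List ℝ → ℝ
  | i, S, [] => C * S / (1 - i * C)
  | i, S, x :: xs =>
    if x < C * S / (1 - i * C) then C * S / (1 - i * C) else tauLoop C (i + 1) (S - x) xs

/-- The threshold `τ` for the weights `w`. -/
def tau {n : ℕ} (C : ℝ) (w : Fin n → ℝ) : ℝ :=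
  tauLoop C 0 (∑ i, w i) ((univ.val.map w).sort (· ≥ ·))

open Classical in
/-- The set `S_null`; the condition says `max_i w_i ≥ C ∑_i w_i`. -/
def nullSet {n : ℕ} (C : ℝ) (w : Fin n → ℝ) : Finset (Fin n) :=
  if ∃ i, C * ∑ j, w j ≤ w i then univ.filter (fun i => tau C w ≤ w i) else ∅

/-- The weights after those in `S_null` have been lowered to `τ`. -/
def cappedWeight {n : ℕ} (C : ℝ) (w : Fin n → ℝ) (i : Fin n) : ℝ :=
  if i ∈ nullSet C w then tau C w else w i

/-- The selection probabilities `p_{i,t}`; they add up to `K`. -/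
def selProb {n : ℕ} (K : ℕ) (γ : ℝ) (w : Fin n → ℝ) (i : Fin n) : ℝ :=
  K * ((1 - γ) * (cappedWeight (capConst n K γ) w i /
    ∑ j, cappedWeight (capConst n K γ) w j) + γ / n)

/-! ### The algorithm -/

/-- The numerical inputs that the constant in the regret bound may depend on. -/
structure HyperParams where
  /-- learning rate `α_t = α / √t` -/
  α : ℝ
  /-- decay rates `β_{1,t} = β₁ lam ^ (t-1)` -/
  β₁ : ℝ
  lam : ℝ
  β₂ : ℝ
  /-- the constant that is added to `√v̂_t` -/
  ε : ℝ
  /-- exploration parameter -/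
  γ : ℝ

/-- The problem and the remaining inputs of a run. -/
structure Setup (d n : ℕ) where
  /-- `loss i θ = ℓ(θ; x_i, y_i)`, the loss on the `i`-th sample of the data set -/
  loss : Fin n → Vec d → ℝ
  /-- batch size -/
  K : ℕ
  /-- the number `p_min` in the loss of the weight update -/
  pmin : ℝ
  /-- initial value of the running maximum of the observed gradient norms -/
  L₀ : ℝ
  /-- the first iterate -/
  θ₁ : Vec d
  /-- how dependent rounding chooses its pairs -/
  rule : PairRule n

/-- The variables of the algorithm between two iterations. -/
structure State (d n : ℕ) where
  θ : Vec d
  m : Fin d → ℝ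
  v : Fin d → ℝ
  vhat : Fin d → ℝ
  w : Fin n → ℝ
  Lmax : ℝ

variable {d n : ℕ}

/-- `α_t` -/
def HyperParams.rate (H : HyperParams) (t : ℕ) : ℝ := H.α / Real.sqrt t

/-- `β_{1,t}`, for `t ≥ 1` -/
def HyperParams.β₁At (H : HyperParams) (t : ℕ) : ℝ := H.β₁ * H.lam ^ (t - 1)

/-- The objective `f(θ; 𝒟) = (1/n) ∑_i ℓ(θ; x_i, y_i)`. -/
def Setup.objective (I : Setup d n) (θ : Vec d) : ℝ := 1 / (n : ℝ) * ∑ i, I.loss i θ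

/-- The probabilities `p_t` that are computed from the current weights. -/
def Setup.prob (I : Setup d n) (H : HyperParams) (s : State d n) : Fin n → ℝ :=
  selProb I.K H.γ s.w

/-- The gradient estimate for the batch `J`: samples are reweighted by the inverse of `n` times
their normalized probability `p_{j,t} / K`, and averaged over the batch. -/
def Setup.gradEst (I : Setup d n) (H : HyperParams) (s : State d n) (J : Finset (Fin n)) :
    Vec d :=
  (1 / (I.K : ℝ)) • ∑ j ∈ J, (1 / (n * (I.prob H s j / I.K))) • gradient (I.loss j) s.θ

/-- `L_t = max (L_{t-1}, max_{j ∈ J_t} ‖g_{j,t}‖)`. -/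
def Setup.newLmax (I : Setup d n) (s : State d n) (J : Finset (Fin n)) : ℝ :=
  J.fold max s.Lmax (fun j => ‖gradient (I.loss j) s.θ‖)

/-- The loss `ℓ_{j,t}` of the weight update, for `j ∈ J_t` (it is `0` if `L_t = 0`). -/
def Setup.armLoss (I : Setup d n) (H : HyperParams) (s : State d n) (J : Finset (Fin n))
    (j : Fin n) : ℝ :=
  if j ∈ J then
    I.pmin ^ 2 / I.newLmax s J ^ 2 *
      (-(‖gradient (I.loss j) s.θ‖ ^ 2 / I.prob H s j ^ 2) + I.newLmax s J ^ 2 / I.pmin ^ 2)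
  else 0

/-- The weight update with unknown gradient bound. -/
def Setup.newWeight (I : Setup d n) (H : HyperParams) (s : State d n) (J : Finset (Fin n))
    (j : Fin n) : ℝ :=
  if j ∈ nullSet (capConst n I.K H.γ) s.w then s.w j
  else s.w j * Real.exp (-(I.K * H.γ * I.armLoss H s J j / n))

def Setup.newM (I : Setup d n) (H : HyperParams) (t : ℕ) (s : State d n) (J : Finset (Fin n))
    (u : Fin d) : ℝ :=
  H.β₁At t * s.m u + (1 - H.β₁At t) * I.gradEst H s J u

def Setup.newV (I : Setup d n) (H : HyperParams) (s : State d n) (J : Finset (Fin n))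
    (u : Fin d) : ℝ :=
  H.β₂ * s.v u + (1 - H.β₂) * I.gradEst H s J u ^ 2

def Setup.newVhat (I : Setup d n) (H : HyperParams) (t : ℕ) (s : State d n)
    (J : Finset (Fin n)) (u : Fin d) : ℝ :=
  if t = 1 then I.newV H s J u
  else max ((1 - H.β₁At t) ^ 2 / (1 - H.β₁At (t - 1)) ^ 2 * s.vhat u) (I.newV H s J u)

/-- Iteration `t ≥ 1` of the algorithm when the selected batch is `J`. -/
def Setup.step (I : Setup d n) (H : HyperParams) (t : ℕ) (s : State d n)
    (J : Finset (Fin n)) : State d n where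
  θ := WithLp.toLp 2 fun u =>
    s.θ u - H.rate t * (I.newM H t s J u / (Real.sqrt (I.newVhat H t s J u) + H.ε))
  m := I.newM H t s J
  v := I.newV H s J
  vhat := I.newVhat H t s J
  w := I.newWeight H s J
  Lmax := I.newLmax s J

def Setup.init (I : Setup d n) : State d n where
  θ := I.θ₁
  m := 0
  v := 0
  vhat := 0
  w := fun _ => 1
  Lmax := I.L₀

/-- The state after `t` iterations, when the batches are `J_1 = J 1, J_2 = J 2, …`. -/
def Setup.state (I : Setup d n) (H : HyperParams) (J : ℕ → Finset (Fin n)) : ℕ → State d n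
  | 0 => I.init
  | t + 1 => I.step H (t + 1) (I.state H J t) (J (t + 1))

/-- The iterate `θ_t`, for `t ≥ 1`. -/
def Setup.iterate (I : Setup d n) (H : HyperParams) (J : ℕ → Finset (Fin n)) (t : ℕ) : Vec d :=
  (I.state H J (t - 1)).θ

/-! ### The law of a run and the regret -/

/-- A possible outcome of the sampling in `T` iterations, `ω k` being the batch `J_{k+1}`;
`batches ω t` is the batch `J_t` (irrelevant unless `1 ≤ t ≤ T`). -/
def batches {T : ℕ} (ω : Fin T → Finset (Fin n)) (t : ℕ) : Finset (Fin n) :=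
  if h : t - 1 < T then ω ⟨t - 1, h⟩ else ∅

/-- The probability of the outcome `ω`: given the past, `J_t` is obtained from `p_t` by dependent
rounding. -/
def Setup.law (I : Setup d n) (H : HyperParams) {T : ℕ} (ω : Fin T → Finset (Fin n)) : ℝ :=
  ∏ t ∈ Icc 1 T, depRound I.rule (I.prob H (I.state H (batches ω) (t - 1))) (batches ω t)

/-- The cumulative regret `𝔼[∑_{t=1}^T f(θ_t; 𝒟) - T min_θ f(θ; 𝒟)]`. -/
def Setup.regret (I : Setup d n) (H : HyperParams) (T : ℕ) : ℝ :=
  ∑ ω : Fin T → Finset (Fin n), I.law H ω *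
    (∑ t ∈ Icc 1 T, I.objective (I.iterate H (batches ω) t) - T * ⨅ θ, I.objective θ)

/-- Bounded gradient: almost surely `‖g_{i,t}‖ ≤ L` for all `i ∈ [n]` and `t ∈ [T]`, where
`g_{i,t} = ∇ℓ(θ_t; x_i, y_i)`. -/
def Setup.BoundedGradient (I : Setup d n) (H : HyperParams) (T : ℕ) (L : ℝ) : Prop :=
  ∀ ω : Fin T → Finset (Fin n), 0 < I.law H ω → ∀ i, ∀ t ∈ Icc 1 T,
    ‖gradient (I.loss i) (I.iterate H (batches ω) t)‖ ≤ L

/-- Bounded parameter: almost surely `‖θ_s - θ_t‖ ≤ D` for all `s, t ∈ [T]`. -/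
def Setup.BoundedParameter (I : Setup d n) (H : HyperParams) (T : ℕ) (D : ℝ) : Prop :=
  ∀ ω : Fin T → Finset (Fin n), 0 < I.law H ω → ∀ s ∈ Icc 1 T, ∀ t ∈ Icc 1 T,
    ‖I.iterate H (batches ω) s - I.iterate H (batches ω) t‖ ≤ D

end

end AdamCB

namespace AdamCB

open Finset

/-! The constant may depend on `γ` and `ε`, so the summand of order `d√T` alone dominates the
regret; the other summand is nonnegative and is only added at the end.

The sampling enters through three facts. Dependent rounding returns batches of size `K` with
marginals `p` (`isBatchLaw_depRound`), so the importance-weighted gradient estimate is unbiased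
(`sum_mul_inner_gradEst`). Every `p_i` is at least `K/n` times a positive number depending only on
`γ` (`prob_spec`): for `γ > 0` by the uniform exploration term, for `γ = 0` because the weights then
stay equal to `1`. Hence the estimate is almost surely bounded by `L / explore γ`
(`norm_gradEst_le`).

The rest is an AMSGrad-type analysis, carried out on each path and in each coordinate
(`IsCoordRun.regret_le`). The rescaled maximum makes `√v̂_t / (1 - β_{1,t})` nondecreasing and
bounded, so the squared distances telescope; the decay of `β_{1,t}` makes the momentum error
summable, and `ε` bounds the step from above. Convexity bounds the regret by the sum of `⟪∇f(θ_t),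
θ_t - θ*⟫`, and replacing `∇f(θ_t)` by the estimate costs a martingale of mean zero
(`sum_law_mul_sum_eq_zero`). -/

/-- A vector of selection probabilities with total mass `K`. -/
structure IsSelVector {n : ℕ} (K : ℕ) (p : Fin n → ℝ) : Prop where
  nonneg : ∀ i, 0 ≤ p i
  le_one : ∀ i, p i ≤ 1
  sum_eq : ∑ i, p i = K

/-- `q` is a probability distribution on batches of size `K` with marginals `p`. -/
structure IsBatchLaw {n : ℕ} (K : ℕ) (p : Fin n → ℝ) (q : Finset (Fin n) → ℝ) : Prop where
  nonneg : ∀ J, 0 ≤ q J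
  sum_eq : ∑ J, q J = 1
  marginal : ∀ i, (∑ J, if i ∈ J then q J else 0) = p i
  card_eq : ∀ J, q J ≠ 0 → J.card = K

/-! ### Dependent rounding: batch size and marginals. -/

section Rounding

variable {n K : ℕ} {p : Fin n → ℝ}

theorem IsSelVector.eq_zero_or_one (hp : IsSelVector K p) {i : Fin n} (hi : ¬ IsFrac (p i)) :
    p i = 0 ∨ p i = 1 := by
  by_contra! h
  exact hi ⟨lt_of_le_of_ne (hp.nonneg i) (Ne.symm h.1), lt_of_le_of_ne (hp.le_one i) h.2⟩

open Classical in
theorem IsSelVector.isBatchLaw_of_not_isFrac (hp : IsSelVector K p) (h : ∀ i, ¬ IsFrac (p i)) :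
    IsBatchLaw K p (fun J => if J = univ.filter (fun i => p i = 1) then 1 else 0) where
  nonneg J := by split_ifs <;> norm_num
  sum_eq := by simp
  marginal i := by
    have : ∀ J : Finset (Fin n), (if i ∈ J then
        (if J = univ.filter (fun i => p i = 1) then (1 : ℝ) else 0) else 0) =
        if J = univ.filter (fun i => p i = 1) then (if p i = 1 then 1 else 0) else 0 := by
      intro J
      by_cases hJ : J = univ.filter (fun i => p i = 1)
      · subst hJ; simp
      · simp [hJ]
    simp only [this, sum_ite_eq', mem_univ, if_true]
    rcases hp.eq_zero_or_one (h i) with h0 | h0 <;> simp [h0]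
  card_eq J hJ := by
    have hJ : J = univ.filter (fun i => p i = 1) := by by_contra h'; simp [h'] at hJ
    have hpi : ∀ i, p i = if p i = 1 then 1 else 0 := fun i => by
      rcases hp.eq_zero_or_one (h i) with h0 | h0 <;> simp [h0]
    have hs := hp.sum_eq
    rw [sum_congr rfl fun i _ => hpi i, sum_boole, ← hJ] at hs
    exact_mod_cast hs

/-- The total mass is an integer, so a fractional entry cannot be the only one. -/
theorem IsSelVector.exists_pair (hp : IsSelVector K p) (h : ∃ i, IsFrac (p i)) :
    ∃ i j, i ≠ j ∧ IsFrac (p i) ∧ IsFrac (p j) := by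
  classical
  obtain ⟨i, hi⟩ := h
  by_contra! hc
  have hpj : ∀ j ∈ univ.erase i, p j = if p j = 1 then 1 else 0 := fun j hj => by
    rcases hp.eq_zero_or_one (hc i j (ne_of_mem_erase hj).symm hi) with h0 | h0 <;> simp [h0]
  have hs := hp.sum_eq
  rw [← add_sum_erase _ _ (mem_univ i), sum_congr rfl hpj, sum_boole] at hs
  obtain ⟨h0, h1⟩ := hi
  have e1 : ((#{x ∈ univ.erase i | p x = 1} : ℕ) : ℝ) < K := by linarith
  have e2 : (K : ℝ) < ((#{x ∈ univ.erase i | p x = 1} + 1 : ℕ) : ℝ) := by push_cast; linarith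
  have e1 := Nat.cast_lt.mp e1
  have e2 := Nat.cast_lt.mp e2
  omega

theorem setPair_apply_left {i j : Fin n} (hij : i ≠ j) (x y : ℝ) : setPair p i j x y i = x := by
  simp [setPair, hij]

theorem setPair_apply_right (i j : Fin n) (x y : ℝ) : setPair p i j x y j = y := by
  simp [setPair]

theorem setPair_apply_of_ne {i j k : Fin n} (hi : k ≠ i) (hj : k ≠ j) (x y : ℝ) :
    setPair p i j x y k = p k := by
  simp [setPair, hi, hj]

theorem sum_setPair {i j : Fin n} (hij : i ≠ j) {x y : ℝ} (h : x + y = p i + p j) :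
    ∑ k, setPair p i j x y k = ∑ k, p k := by
  have hj : j ∈ univ.erase i := mem_erase.2 ⟨hij.symm, mem_univ j⟩
  rw [← add_sum_erase _ _ (mem_univ i), ← add_sum_erase _ _ hj,
    ← add_sum_erase (a := i) _ p (mem_univ i), ← add_sum_erase _ p hj,
    setPair_apply_left hij, setPair_apply_right, ← add_assoc, ← add_assoc, h]
  congr 1
  refine sum_congr rfl fun k hk => setPair_apply_of_ne ?_ ?_ x y
  · exact ne_of_mem_erase (mem_of_mem_erase hk)
  · exact ne_of_mem_erase hk

theorem IsSelVector.setPair (hp : IsSelVector K p) {i j : Fin n} (hij : i ≠ j) {x y : ℝ}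
    (h : x + y = p i + p j) (hx : 0 ≤ x ∧ x ≤ 1) (hy : 0 ≤ y ∧ y ≤ 1) :
    IsSelVector K (setPair p i j x y) := by
  have key : ∀ k, 0 ≤ AdamCB.setPair p i j x y k ∧ AdamCB.setPair p i j x y k ≤ 1 := fun k => by
    by_cases hk : k = j
    · rw [hk, setPair_apply_right]; exact hy
    · by_cases hk' : k = i
      · rw [hk', setPair_apply_left hij]; exact hx
      · rw [setPair_apply_of_ne hk' hk]; exact ⟨hp.nonneg k, hp.le_one k⟩
  exact ⟨fun k => (key k).1, fun k => (key k).2, (sum_setPair hij h).trans hp.sum_eq⟩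

open Classical in
theorem card_isFrac_setPair_lt {i j : Fin n} (hij : i ≠ j) {x y : ℝ} (hi : IsFrac (p i))
    (hj : IsFrac (p j)) (hxy : ¬ IsFrac x ∨ ¬ IsFrac y) :
    #{k | IsFrac (setPair p i j x y k)} < #{k | IsFrac (p k)} := by
  refine card_lt_card (ssubset_iff_of_subset ?_ |>.2 ?_)
  · intro k hk
    simp only [mem_filter, mem_univ, true_and] at hk ⊢
    by_cases h1 : k = j
    · rw [h1]; exact hj
    · by_cases h2 : k = i
      · rw [h2]; exact hi
      · rwa [setPair_apply_of_ne h2 h1] at hk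
  · rcases hxy with h | h
    · exact ⟨i, by simpa using hi, by simpa [setPair_apply_left hij] using h⟩
    · exact ⟨j, by simpa using hj, by simpa [setPair_apply_right] using h⟩

theorem IsBatchLaw.mix {r s : Fin n → ℝ} {q q' : Finset (Fin n) → ℝ} (h : IsBatchLaw K r q)
    (h' : IsBatchLaw K s q') {c c' : ℝ} (hc : 0 ≤ c) (hc' : 0 ≤ c') (hcc : c + c' = 1)
    (hp : ∀ i, c * r i + c' * s i = p i) : IsBatchLaw K p (fun J => c * q J + c' * q' J) where
  nonneg J := add_nonneg (mul_nonneg hc (h.nonneg J)) (mul_nonneg hc' (h'.nonneg J))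
  sum_eq := by rw [sum_add_distrib, ← mul_sum, ← mul_sum, h.sum_eq, h'.sum_eq]; linarith
  marginal i := by
    rw [← hp i, ← h.marginal i, ← h'.marginal i, mul_sum, mul_sum, ← sum_add_distrib]
    exact sum_congr rfl fun J _ => by split_ifs <;> simp
  card_eq J hJ := by
    by_cases h0 : q J = 0
    · refine h'.card_eq J fun h1 => hJ ?_
      rw [h0, h1]; ring
    · exact h.card_eq J h0

-- A round is a mean-preserving two-point mixture that makes at least one entry integral. The number
-- of fractional entries thus bounds the rounds still needed, and the induction runs on it.
open Classical in
theorem isBatchLaw_depRoundAux (rule : PairRule n) (k : ℕ) (hp : IsSelVector K p)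
    (hk : #{i | IsFrac (p i)} ≤ k) : IsBatchLaw K p (depRoundAux rule k p) := by
  induction k generalizing p with
  | zero =>
    have h : ∀ i, ¬ IsFrac (p i) := by
      simpa [filter_eq_empty_iff] using hk
    convert! hp.isBatchLaw_of_not_isFrac h using 1
  | succ k ih =>
    by_cases h : ∃ i, IsFrac (p i)
    · obtain ⟨hij, hi, hj⟩ := rule.valid p (hp.exists_pair h)
      set i := (rule.pick p).1 with hi_def
      set j := (rule.pick p).2 with hj_def
      set a := min (1 - p i) (p j) with ha_def
      set b := min (p i) (1 - p j) with hb_def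
      have ha : 0 < a := lt_min (by linarith [hi.2]) hj.1
      have hb : 0 < b := lt_min hi.1 (by linarith [hj.2])
      have ha1 : a ≤ 1 - p i := min_le_left _ _
      have ha2 : a ≤ p j := min_le_right _ _
      have hb1 : b ≤ p i := min_le_left _ _
      have hb2 : b ≤ 1 - p j := min_le_right _ _
      have hab : a + b ≠ 0 := by positivity
      have e : depRoundAux rule (k + 1) p = fun J =>
          b / (a + b) * depRoundAux rule k (setPair p i j (p i + a) (p j - a)) J
          + a / (a + b) * depRoundAux rule k (setPair p i j (p i - b) (p j + b)) J := by
        funext J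
        rw [depRoundAux, if_pos h]
      -- Whichever argument attains the minimum `a`, the first entry becomes `1` or the second
      -- becomes `0`; similarly for `b` below.
      have l1 := card_isFrac_setPair_lt (x := p i + a) (y := p j - a) hij hi hj (by
        rcases min_choice (1 - p i) (p j) with h | h
        · left; rintro ⟨-, h'⟩; linarith
        · right; rintro ⟨h', -⟩; linarith)
      have l2 := card_isFrac_setPair_lt (x := p i - b) (y := p j + b) hij hi hj (by
        rcases min_choice (p i) (1 - p j) with h | h
        · left; rintro ⟨h', -⟩; linarith
        · right; rintro ⟨-, h'⟩; linarith)
      rw [e]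
      refine (ih (hp.setPair hij (by ring) ⟨by linarith [hi.1], by linarith⟩
        ⟨by linarith, by linarith [hj.2]⟩) (by omega)).mix
        (ih (hp.setPair hij (by ring) ⟨by linarith, by linarith [hi.2]⟩
        ⟨by linarith [hj.1], by linarith⟩) (by omega)) (by positivity) (by positivity)
        (by field_simp; ring) fun u => ?_
      -- The mean is preserved since `b * a - a * b = 0`.
      by_cases hu : u = j
      · rw [hu, setPair_apply_right, setPair_apply_right]; field_simp; ring
      · by_cases hu' : u = i
        · rw [hu', setPair_apply_left hij, setPair_apply_left hij]; field_simp; ring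
        · rw [setPair_apply_of_ne hu' hu, setPair_apply_of_ne hu' hu]; field_simp; ring
    · have e : depRoundAux rule (k + 1) p =
          fun J => if J = univ.filter (fun i => p i = 1) then 1 else 0 := by
        funext J
        rw [depRoundAux, if_neg h]
      rw [e]
      convert! hp.isBatchLaw_of_not_isFrac (not_exists.1 h) using 1

theorem isBatchLaw_depRound (rule : PairRule n) (hp : IsSelVector K p) :
    IsBatchLaw K p (depRound rule p) := by
  classical
  exact isBatchLaw_depRoundAux rule n hp ((card_le_univ _).trans (by simp))

end Rounding

/-! ### Weight capping and the range of the selection probabilities. -/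

section Capping

/-- The threshold is a fixed point: with the `i` removed weights counted as `τ` and the others cut
at `τ`, the total times `C` is `τ`. The upper bound by the current threshold is what the induction
needs: a removed weight is at least the current threshold, hence at least the final `τ`, and is
indeed cut to `τ`. -/
theorem tauLoop_spec {C : ℝ} (hC : 0 < C) (l : List ℝ) (i : ℕ) (hl : l.Pairwise (· ≥ ·))
    (hpos : ∀ x ∈ l, 0 < x) (hi : i * C < 1) (hn : 1 < (i + l.length : ℕ) * C) :
    0 < tauLoop C i l.sum l ∧ tauLoop C i l.sum l ≤ C * l.sum / (1 - i * C) ∧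
      C * (i * tauLoop C i l.sum l + (l.map fun x => min x (tauLoop C i l.sum l)).sum) =
        tauLoop C i l.sum l := by
  induction l generalizing i with
  | nil => simp at hn; linarith
  | cons x l ih =>
    have hx : 0 < x := hpos x (by simp)
    have hpos' : ∀ y ∈ l, 0 < y := fun y hy => hpos y (by simp [hy])
    have hs : 0 ≤ l.sum := List.sum_nonneg fun y hy => (hpos' y hy).le
    have hd : 0 < 1 - i * C := by linarith
    obtain ⟨hxl, hl'⟩ := List.pairwise_cons.1 hl
    rw [tauLoop]
    split_ifs with h
    · set τ := C * (x :: l).sum / (1 - i * C) with hτ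
      refine ⟨hx.trans h, le_rfl, ?_⟩
      have e : ((x :: l).map fun y => min y τ) = x :: l := by
        conv_rhs => rw [← List.map_id (x :: l)]
        refine List.map_congr_left fun y hy => min_eq_left ?_
        rcases List.mem_cons.1 hy with rfl | hy
        · exact h.le
        · exact (hxl y hy).le.trans h.le
      have e2 : τ * (1 - i * C) = C * (x :: l).sum := div_mul_cancel₀ _ hd.ne'
      rw [e]
      linarith
    · push Not at h
      have hsub : (x :: l).sum - x = l.sum := by simp
      rw [hsub]
      have h' : C * (x + l.sum) ≤ x * (1 - i * C) := by
        rwa [div_le_iff₀ hd, List.sum_cons] at h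
      -- Denominators stay positive: by `h'`, a positive remaining sum forces `(i + 1) * C < 1`,
      -- while an exhausted list would give `(i + 1) * C ≤ 1`, against `hn`.
      have hi' : ((i + 1 : ℕ) : ℝ) * C < 1 := by
        push_cast
        rcases l with _ | ⟨y, l⟩
        · simp at hn h'
          nlinarith
        · have : 0 < (y :: l).sum := by
            rw [List.sum_cons]
            have := hpos' y (by simp)
            have : 0 ≤ l.sum := List.sum_nonneg fun z hz => (hpos' z (by simp [hz])).le
            linarith
          have : 0 < C * (y :: l).sum := by positivity
          nlinarith
      obtain ⟨h1, h2, h3⟩ := ih (i + 1) hl' hpos' hi' (by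
        simp only [List.length_cons] at hn
        rwa [show i + 1 + l.length = i + (l.length + 1) by ring])
      set τ := tauLoop C (i + 1) l.sum l with hτ
      have hd' : 0 < 1 - ((i + 1 : ℕ) : ℝ) * C := by linarith
      have h4 : C * l.sum / (1 - ((i + 1 : ℕ) : ℝ) * C) ≤ C * (x :: l).sum / (1 - i * C) := by
        rw [div_le_div_iff₀ hd' hd, List.sum_cons]
        push_cast
        nlinarith
      refine ⟨h1, h2.trans h4, ?_⟩
      rw [List.map_cons, List.sum_cons, min_eq_right ((h2.trans h4).trans h)]
      push_cast at h3
      linarith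

variable {n : ℕ} {w : Fin n → ℝ}

theorem tau_spec {C : ℝ} (hC : 0 < C) (hw : ∀ i, 0 < w i) (hn : 1 < n * C) :
    0 < tau C w ∧ C * ∑ i, min (w i) (tau C w) = tau C w := by
  set l := (univ.val.map w).sort (· ≥ ·) with hl
  have hlc : (l : Multiset ℝ) = univ.val.map w := Multiset.sort_eq _ _
  have hsum : l.sum = ∑ i, w i := by
    rw [← Multiset.sum_coe, hlc]; rfl
  have hlen : l.length = n := by simp [hl]
  have hpos : ∀ x ∈ l, 0 < x := fun x hx => by
    rw [hl, Multiset.mem_sort] at hx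
    obtain ⟨i, -, rfl⟩ := Multiset.mem_map.1 hx
    exact hw i
  have h := tauLoop_spec hC l 0 (Multiset.pairwise_sort _ _) hpos (by simp) (by
    rwa [hlen, zero_add])
  rw [hsum] at h
  refine ⟨h.1, ?_⟩
  have h3 := h.2.2
  rw [← Multiset.sum_coe, ← Multiset.map_coe, hlc, Multiset.map_map] at h3
  rw [Nat.cast_zero, zero_mul, zero_add] at h3
  exact h3

/-- When capping is active the new weights are `min (w i) τ`, and the fixed-point equation for `τ`
is the claimed bound; otherwise the bound is the failure of the capping condition. -/
theorem cappedWeight_spec {C : ℝ} (hC : 0 < C) (hw : ∀ i, 0 < w i) (hn : 1 < n * C) (i : Fin n) :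
    0 < cappedWeight C w i ∧ cappedWeight C w i ≤ C * ∑ j, cappedWeight C w j := by
  by_cases h : ∃ i, C * ∑ j, w j ≤ w i
  · have e : ∀ i, cappedWeight C w i = min (w i) (tau C w) := fun i => by
      simp only [cappedWeight, nullSet, if_pos h, mem_filter, mem_univ, true_and]
      split_ifs with h'
      · rw [min_eq_right h']
      · rw [min_eq_left (not_le.1 h').le]
    obtain ⟨h1, h2⟩ := tau_spec hC hw hn
    simp only [e]
    exact ⟨lt_min (hw i) h1, (min_le_right _ _).trans_eq h2.symm⟩
  · have e : ∀ i, cappedWeight C w i = w i := fun i => by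
      simp [cappedWeight, nullSet, if_neg h]
    push Not at h
    simp only [e]
    exact ⟨hw i, (h i).le⟩

variable {K : ℕ} {γ : ℝ}

theorem one_div_le_capConst (hK : 1 ≤ K) (hKn : K < n) (hγ : 0 ≤ γ ∧ γ < 1) :
    1 / (K : ℝ) ≤ capConst n K γ := by
  have hK' : (0 : ℝ) < K := by exact_mod_cast hK
  have hKn' : (K : ℝ) ≤ n := by exact_mod_cast hKn.le
  rw [capConst, le_div_iff₀ (by linarith [hγ.2])]
  have h : γ / n ≤ γ / K := div_le_div_of_nonneg_left hγ.1 hK' hKn'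
  have : 1 / (K : ℝ) * (1 - γ) = 1 / K - γ / K := by ring
  linarith

/-- `capConst` solves `K * ((1 - γ) * C + γ / n) = 1`, so a share of at most `C` means a probability
of at most `1`. The lower bound is the exploration term. -/
theorem selProb_spec (hK : 1 ≤ K) (hKn : K < n) (hγ : 0 ≤ γ ∧ γ < 1) (hw : ∀ i, 0 < w i) :
    IsSelVector K (selProb K γ w) ∧ ∀ i, K * γ / n ≤ selProb K γ w i := by
  have hK' : (0 : ℝ) < K := by exact_mod_cast hK
  have hKn' : (K : ℝ) < n := by exact_mod_cast hKn
  have hn' : (0 : ℝ) < n := hK'.trans hKn'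
  have hC := one_div_le_capConst hK hKn hγ
  have hC0 : 0 < capConst n K γ := lt_of_lt_of_le (by positivity) hC
  have hnC : 1 < n * capConst n K γ := by
    rw [div_le_iff₀ hK'] at hC
    nlinarith
  have hγ' : 0 < 1 - γ := by linarith [hγ.2]
  set c := cappedWeight (capConst n K γ) w with hc
  have hcs := cappedWeight_spec hC0 hw hnC
  have hS : 0 < ∑ j, c j := by
    have : Nonempty (Fin n) := ⟨⟨0, by omega⟩⟩
    exact sum_pos (fun i _ => (hcs i).1) univ_nonempty
  have hq : ∀ i, 0 ≤ c i / ∑ j, c j := fun i => div_nonneg (hcs i).1.le hS.le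
  have hlow : ∀ i, K * γ / n ≤ selProb K γ w i := fun i => by
    have h : 0 ≤ K * ((1 - γ) * (c i / ∑ j, c j)) := mul_nonneg hK'.le (mul_nonneg hγ'.le (hq i))
    have e : selProb K γ w i = K * ((1 - γ) * (c i / ∑ j, c j)) + K * γ / n := by
      rw [selProb]; ring
    linarith
  refine ⟨⟨fun i => le_trans (div_nonneg (mul_nonneg hK'.le hγ.1) hn'.le) (hlow i),
    fun i => ?_, ?_⟩, hlow⟩
  · have h : c i / ∑ j, c j ≤ capConst n K γ := (div_le_iff₀ hS).2 (hcs i).2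
    have e : (1 - γ) * capConst n K γ = 1 / K - γ / n := by
      rw [capConst]; field_simp
    calc selProb K γ w i ≤ K * ((1 - γ) * capConst n K γ + γ / n) := by
          rw [selProb]; gcongr
      _ = 1 := by rw [e]; field_simp; ring
  · simp only [selProb]
    rw [← mul_sum, sum_add_distrib, ← mul_sum, ← sum_div, div_self hS.ne']
    simp
    field_simp
    ring

/-- Equal shares `1/n` lie below `C = 1/K`, so nothing is capped. -/
theorem selProb_of_const (hK : 1 ≤ K) (hKn : K < n) (hw : ∀ i, w i = 1) (i : Fin n) :
    selProb K 0 w i = K / n := by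
  have hK' : (0 : ℝ) < K := by exact_mod_cast hK
  have hKn' : (K : ℝ) < n := by exact_mod_cast hKn
  have h : ¬ ∃ i, capConst n K 0 * ∑ j, w j ≤ w i := by
    push Not
    intro i
    simp only [capConst, hw, sum_const, card_univ, Fintype.card_fin, nsmul_eq_mul]
    simp
    rw [← div_eq_inv_mul, lt_div_iff₀ hK']
    linarith
  simp [selProb, cappedWeight, nullSet, if_neg h, hw]
  ring

end Capping

/-! ### Deterministic regret of one coordinate of the adaptive method. -/

section AdaptiveStep

/-- The constant in the regret bound of one coordinate, when the gradient estimates are bounded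
by `G` and the distances to the comparator by `B`. -/
noncomputable def regretConst (H : HyperParams) (G B : ℝ) : ℝ :=
  B ^ 2 * (H.ε + G / (1 - H.β₁)) / (2 * H.α)
    + (B ^ 2 * H.ε / (2 * H.α) + G * B) / (1 - H.β₁) / (1 - H.lam)
    + H.α * G ^ 2 / (H.ε * (1 - H.β₁))

/-- One coordinate of a run of the adaptive method with gradient estimates `g`, in which `x t` is
the displacement from the comparator after `t` iterations. -/
structure IsCoordRun (H : HyperParams) (g m v vh x : ℕ → ℝ) : Prop where
  m_zero : m 0 = 0
  v_zero : v 0 = 0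
  m_succ : ∀ t, m (t + 1) = H.β₁At (t + 1) * m t + (1 - H.β₁At (t + 1)) * g t
  v_succ : ∀ t, v (t + 1) = H.β₂ * v t + (1 - H.β₂) * g t ^ 2
  vh_succ : ∀ t, vh (t + 1) = if t + 1 = 1 then v (t + 1) else
    max ((1 - H.β₁At (t + 1)) ^ 2 / (1 - H.β₁At (t + 1 - 1)) ^ 2 * vh t) (v (t + 1))
  x_succ : ∀ t, x (t + 1) = x t - H.rate (t + 1) * (m (t + 1) / (√(vh (t + 1)) + H.ε))

variable {H : HyperParams} {g m v vh x : ℕ → ℝ} {G B : ℝ} {T : ℕ}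

theorem β₁At_succ (H : HyperParams) (t : ℕ) : H.β₁At (t + 1) = H.β₁ * H.lam ^ t := rfl

theorem β₁At_mem (hβ₁ : 0 ≤ H.β₁ ∧ H.β₁ < 1) (hlam : 0 < H.lam ∧ H.lam < 1) (t : ℕ) :
    0 ≤ H.β₁At t ∧ H.β₁At t ≤ H.β₁ :=
  ⟨mul_nonneg hβ₁.1 (pow_nonneg hlam.1.le _),
    mul_le_of_le_one_right hβ₁.1 (pow_le_one₀ hlam.1.le hlam.2.le)⟩

theorem IsCoordRun.abs_m_le (h : IsCoordRun H g m v vh x) (hβ₁ : 0 ≤ H.β₁ ∧ H.β₁ < 1)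
    (hlam : 0 < H.lam ∧ H.lam < 1) (hG : 0 ≤ G) (hg : ∀ t < T, |g t| ≤ G) :
    ∀ t ≤ T, |m t| ≤ G := by
  intro t
  induction t with
  | zero => intro; simpa [h.m_zero] using hG
  | succ t ih =>
    intro ht
    obtain ⟨h0, h1⟩ := β₁At_mem hβ₁ hlam (t + 1)
    have h2 : 0 ≤ 1 - H.β₁At (t + 1) := by linarith [hβ₁.2]
    rw [h.m_succ]
    calc _ ≤ H.β₁At (t + 1) * |m t| + (1 - H.β₁At (t + 1)) * |g t| := by
          refine (abs_add_le _ _).trans_eq ?_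
          rw [abs_mul, abs_mul, abs_of_nonneg h0, abs_of_nonneg h2]
      _ ≤ H.β₁At (t + 1) * G + (1 - H.β₁At (t + 1)) * G := by
          gcongr
          · exact ih (by omega)
          · exact hg t (by omega)
      _ = G := by ring

theorem IsCoordRun.v_mem (h : IsCoordRun H g m v vh x) (hβ₂ : 0 ≤ H.β₂ ∧ H.β₂ < 1)
    (hg : ∀ t < T, |g t| ≤ G) : ∀ t ≤ T, 0 ≤ v t ∧ v t ≤ G ^ 2 := by
  intro t
  induction t with
  | zero => intro; simpa [h.v_zero] using sq_nonneg G
  | succ t ih =>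
    intro ht
    have h2 : 0 ≤ 1 - H.β₂ := by linarith [hβ₂.2]
    obtain ⟨h3, h4⟩ := ih (by omega)
    have h5 : g t ^ 2 ≤ G ^ 2 := sq_le_sq.2 ((hg t (by omega)).trans (le_abs_self G))
    rw [h.v_succ]
    refine ⟨add_nonneg (mul_nonneg hβ₂.1 h3) (mul_nonneg h2 (sq_nonneg _)), ?_⟩
    calc _ ≤ H.β₂ * G ^ 2 + (1 - H.β₂) * G ^ 2 := by
          gcongr
          exact hβ₂.1
      _ = G ^ 2 := by ring

/-- `v̂_t / (1 - β_{1,t})²` is the running maximum of `v_s / (1 - β_{1,s})²`, and each of these is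
at most `G² / (1 - β₁)²`. -/
theorem IsCoordRun.sqrt_vh_div_le (h : IsCoordRun H g m v vh x) (hβ₁ : 0 ≤ H.β₁ ∧ H.β₁ < 1)
    (hlam : 0 < H.lam ∧ H.lam < 1) (hβ₂ : 0 ≤ H.β₂ ∧ H.β₂ < 1) (hG : 0 ≤ G)
    (hg : ∀ t < T, |g t| ≤ G) :
    ∀ t < T, √(vh (t + 1)) / (1 - H.β₁At (t + 1)) ≤ G / (1 - H.β₁) := by
  have hpos : ∀ t, 0 < 1 - H.β₁At t := fun t => by linarith [(β₁At_mem hβ₁ hlam t).2, hβ₁.2]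
  have hb : 0 < 1 - H.β₁ := by linarith [hβ₁.2]
  have hv : ∀ t < T, v (t + 1) ≤ ((1 - H.β₁At (t + 1)) * (G / (1 - H.β₁))) ^ 2 := fun t ht => by
    refine (h.v_mem hβ₂ hg (t + 1) ht).2.trans (pow_le_pow_left₀ hG ?_ 2)
    rw [mul_div_assoc', le_div_iff₀ hb, mul_comm]
    gcongr
    exact (β₁At_mem hβ₁ hlam (t + 1)).2
  have key : ∀ t < T, vh (t + 1) ≤ ((1 - H.β₁At (t + 1)) * (G / (1 - H.β₁))) ^ 2 := by
    intro t
    induction t with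
    | zero => intro ht; rw [h.vh_succ, if_pos rfl]; exact hv 0 ht
    | succ t ih =>
      intro ht
      rw [h.vh_succ, if_neg (by omega), Nat.add_sub_cancel]
      refine max_le ?_ (hv _ ht)
      have := hpos (t + 1)
      calc _ ≤ (1 - H.β₁At (t + 1 + 1)) ^ 2 / (1 - H.β₁At (t + 1)) ^ 2 *
            ((1 - H.β₁At (t + 1)) * (G / (1 - H.β₁))) ^ 2 := by
            gcongr
            exact ih (by omega)
        _ = _ := by field_simp
  intro t ht
  rw [div_le_iff₀ (hpos _), mul_comm]
  exact Real.sqrt_le_iff.2 ⟨mul_nonneg (hpos _).le (by positivity), key t ht⟩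

theorem IsCoordRun.sqrt_vh_div_mono (h : IsCoordRun H g m v vh x) (hβ₁ : 0 ≤ H.β₁ ∧ H.β₁ < 1)
    (hlam : 0 < H.lam ∧ H.lam < 1) (t : ℕ) :
    √(vh (t + 1)) / (1 - H.β₁At (t + 1)) ≤ √(vh (t + 2)) / (1 - H.β₁At (t + 2)) := by
  have hpos : ∀ t, 0 < 1 - H.β₁At t := fun t => by linarith [(β₁At_mem hβ₁ hlam t).2, hβ₁.2]
  have h1 := hpos (t + 1)
  have h2 := hpos (t + 2)
  have h3 : (1 - H.β₁At (t + 2)) ^ 2 / (1 - H.β₁At (t + 1)) ^ 2 * vh (t + 1) ≤ vh (t + 2) := by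
    rw [h.vh_succ (t + 1), if_neg (by omega), Nat.add_sub_cancel]
    exact le_max_left _ _
  have h4 := Real.sqrt_le_sqrt h3
  rw [Real.sqrt_mul (by positivity), ← div_pow, Real.sqrt_sq (by positivity)] at h4
  rw [div_le_div_iff₀ h1 h2]
  rw [div_mul_eq_mul_div, div_le_iff₀ h1] at h4
  linarith

/-- The telescoping part of the inverse step size after `t` iterations. -/
noncomputable def invStep (H : HyperParams) (vh : ℕ → ℝ) : ℕ → ℝ
  | 0 => 0
  | t + 1 => √(t + 1 : ℕ) * (H.ε + √(vh (t + 1)) / (1 - H.β₁At (t + 1))) / (2 * H.α)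

/-- The true inverse step has `ε / (1 - β_{1,t})`, which is nonincreasing in `t`. Keeping only `ε`
restores monotonicity; the excess `ε * β_{1,t} / (1 - β_{1,t})` goes into the geometric error of
`IsCoordRun.mul_le`. -/
theorem IsCoordRun.invStep_mono (h : IsCoordRun H g m v vh x) (hα : 0 < H.α)
    (hβ₁ : 0 ≤ H.β₁ ∧ H.β₁ < 1) (hlam : 0 < H.lam ∧ H.lam < 1) (hε : 0 < H.ε) (t : ℕ) :
    invStep H vh t ≤ invStep H vh (t + 1) := by
  have hpos : ∀ t, 0 < 1 - H.β₁At t := fun t => by linarith [(β₁At_mem hβ₁ hlam t).2, hβ₁.2]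
  rcases t with _ | t
  · have := hpos (0 + 1)
    rw [invStep, invStep]
    positivity
  · have h1 := hpos (t + 1)
    have h2 := h.sqrt_vh_div_mono hβ₁ hlam t
    rw [invStep, invStep]
    gcongr
    omega

/-- Solve the momentum recursion for the gradient and expand the square of the next displacement.
Besides the telescoping term there remain two terms with a factor `β_{1,t} / (1 - β_{1,t})`,
geometrically small, and the squared step. -/
theorem IsCoordRun.mul_le (h : IsCoordRun H g m v vh x) (hα : 0 < H.α)
    (hβ₁ : 0 ≤ H.β₁ ∧ H.β₁ < 1) (hlam : 0 < H.lam ∧ H.lam < 1) (hε : 0 < H.ε) (hG : 0 ≤ G)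
    (hB : 0 ≤ B) (hg : ∀ t < T, |g t| ≤ G) (hx : ∀ t < T, |x t| ≤ B) {t : ℕ} (ht : t < T) :
    g t * x t ≤ invStep H vh (t + 1) * (x t ^ 2 - x (t + 1) ^ 2)
      + √T * ((B ^ 2 * H.ε / (2 * H.α) + G * B) / (1 - H.β₁) * H.lam ^ t)
      + H.α * G ^ 2 / (2 * H.ε * (1 - H.β₁)) * (1 / √(t + 1 : ℕ)) := by
  obtain ⟨hb0, hb1⟩ := β₁At_mem hβ₁ hlam (t + 1)
  have hb : 0 < 1 - H.β₁ := by linarith [hβ₁.2]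
  have hm := h.m_succ t
  have hxs := h.x_succ t
  have hM := h.abs_m_le hβ₁ hlam hG hg
  have hM0 := hM t ht.le
  have hM1 := hM (t + 1) ht
  have hx0 := hx t ht
  have hbl : H.β₁At (t + 1) ≤ H.lam ^ t := by
    rw [β₁At_succ]; exact mul_le_of_le_one_left (pow_nonneg hlam.1.le _) hβ₁.2.le
  have hsT : √(t + 1 : ℕ) ≤ √T := Real.sqrt_le_sqrt (by exact_mod_cast ht)
  have hs1 : 1 ≤ √(t + 1 : ℕ) := Real.one_le_sqrt.2 (by push_cast; linarith [Nat.cast_nonneg (α := ℝ) t])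
  rw [invStep]
  rw [HyperParams.rate] at hxs
  have hlp : 0 ≤ H.lam ^ t := pow_nonneg hlam.1.le _
  generalize H.lam ^ t = p at hbl hlp ⊢
  generalize H.β₁At (t + 1) = b at hb0 hb1 hbl hm ⊢
  generalize √(t + 1 : ℕ) = s at hs1 hsT hxs ⊢
  have hr : 0 ≤ √(vh (t + 1)) := Real.sqrt_nonneg _
  generalize √(vh (t + 1)) = r at hr hxs ⊢
  generalize m (t + 1) = m1 at hM1 hm hxs
  generalize m t = m0 at hM0 hm
  generalize g t = gt at hm ⊢
  generalize x (t + 1) = x1 at hxs ⊢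
  generalize x t = x0 at hxs hx0 ⊢
  generalize √(T : ℝ) = sT at hsT ⊢
  have hb' : 0 < 1 - b := by linarith
  have hs : 0 < s := by linarith
  have hsT0 : 0 ≤ sT := by linarith
  have hre : 0 < r + H.ε := by linarith
  have hgt : gt = (m1 - b * m0) / (1 - b) := by rw [hm]; field_simp; ring
  have id : gt * x0 = s * (H.ε + r / (1 - b)) / (2 * H.α) * (x0 ^ 2 - x1 ^ 2)
      + s * H.ε * (b / (1 - b)) / (2 * H.α) * (x0 ^ 2 - x1 ^ 2)
      + H.α * m1 ^ 2 / (2 * (r + H.ε) * (1 - b)) * (1 / s)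
      + b / (1 - b) * (- (m0 * x0)) := by
    rw [hgt, hxs]
    field_simp
    ring
  have hbb : b / (1 - b) ≤ p / (1 - H.β₁) := by gcongr
  have hbb0 : 0 ≤ b / (1 - b) := by positivity
  -- Only `x0` is known to be bounded by `B`: the displacement after the last iteration is not
  -- controlled, so its square is dropped.
  have hx2 : x0 ^ 2 - x1 ^ 2 ≤ B ^ 2 := by
    have : x0 ^ 2 ≤ B ^ 2 := sq_le_sq.2 (hx0.trans (le_abs_self B))
    linarith [sq_nonneg x1]
  have hm2 : m1 ^ 2 ≤ G ^ 2 := sq_le_sq.2 (hM1.trans (le_abs_self G))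
  have hmx : - (m0 * x0) ≤ G * B := by
    refine (neg_le_abs _).trans ?_
    rw [abs_mul]
    gcongr
  have e1 : s * H.ε * (b / (1 - b)) / (2 * H.α) * (x0 ^ 2 - x1 ^ 2) ≤
      sT * H.ε * (p / (1 - H.β₁)) / (2 * H.α) * B ^ 2 :=
    (mul_le_mul_of_nonneg_left hx2 (by positivity)).trans (by gcongr)
  have e2 : H.α * m1 ^ 2 / (2 * (r + H.ε) * (1 - b)) * (1 / s) ≤
      H.α * G ^ 2 / (2 * H.ε * (1 - H.β₁)) * (1 / s) := by
    gcongr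
    linarith
  have e3 : b / (1 - b) * (- (m0 * x0)) ≤ sT * (p / (1 - H.β₁) * (G * B)) :=
    calc b / (1 - b) * (- (m0 * x0)) ≤ b / (1 - b) * (G * B) := by gcongr
      _ ≤ p / (1 - H.β₁) * (G * B) := by gcongr
      _ ≤ _ := le_mul_of_one_le_left (by positivity) (by linarith)
  have e4 : sT * ((B ^ 2 * H.ε / (2 * H.α) + G * B) / (1 - H.β₁) * p) =
      sT * H.ε * (p / (1 - H.β₁)) / (2 * H.α) * B ^ 2 + sT * (p / (1 - H.β₁) * (G * B)) := by
    field_simp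
  linarith

theorem sum_one_div_sqrt_le (T : ℕ) : ∑ t ∈ range T, 1 / √(t + 1 : ℕ) ≤ 2 * √T := by
  induction T with
  | zero => simp
  | succ T ih =>
    rw [sum_range_succ]
    have h : 1 / √(T + 1 : ℕ) ≤ 2 * (√(T + 1 : ℕ) - √T) := by
      have h1 : 0 < √(T + 1 : ℕ) := Real.sqrt_pos.2 (by positivity)
      have h2 := Real.sq_sqrt (Nat.cast_nonneg (α := ℝ) (T + 1))
      have h3 := Real.sq_sqrt (Nat.cast_nonneg (α := ℝ) T)
      push_cast at h1 h2 h3 ⊢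
      rw [div_le_iff₀ h1]
      nlinarith [sq_nonneg (√(T + 1 : ℝ) - √T)]
    linarith

theorem sum_pow_le {r : ℝ} (h0 : 0 ≤ r) (h1 : r < 1) (T : ℕ) :
    ∑ t ∈ range T, r ^ t ≤ 1 / (1 - r) := by
  rw [one_div, ← tsum_geometric_of_lt_one h0 h1]
  exact (summable_geometric_of_lt_one h0 h1).sum_le_tsum _ fun _ _ => pow_nonneg h0 _

theorem IsCoordRun.regret_le (h : IsCoordRun H g m v vh x) (hα : 0 < H.α)
    (hβ₁ : 0 ≤ H.β₁ ∧ H.β₁ < 1) (hlam : 0 < H.lam ∧ H.lam < 1) (hβ₂ : 0 ≤ H.β₂ ∧ H.β₂ < 1)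
    (hε : 0 < H.ε) (hG : 0 ≤ G) (hB : 0 ≤ B) (hg : ∀ t < T, |g t| ≤ G)
    (hx : ∀ t < T, |x t| ≤ B) :
    ∑ t ∈ range T, g t * x t ≤ regretConst H G B * √T := by
  have hb : 0 < 1 - H.β₁ := by linarith [hβ₁.2]
  have hl : 0 < 1 - H.lam := by linarith [hlam.2]
  -- Abel summation as an induction: raising the coefficient from `invStep t` to `invStep (t + 1)`
  -- is harmless because it multiplies `B ^ 2 - x t ^ 2 ≥ 0`.
  have tel : ∀ t ≤ T, ∑ s ∈ range t, invStep H vh (s + 1) * (x s ^ 2 - x (s + 1) ^ 2) ≤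
      invStep H vh t * (B ^ 2 - x t ^ 2) := by
    intro t
    induction t with
    | zero => intro; simp [invStep]
    | succ t ih =>
      intro ht
      rw [sum_range_succ]
      have h1 := ih (by omega)
      have h2 := h.invStep_mono hα hβ₁ hlam hε t
      have h3 : x t ^ 2 ≤ B ^ 2 := sq_le_sq.2 ((hx t (by omega)).trans (le_abs_self B))
      nlinarith
  have hcT : invStep H vh T ≤ √T * (H.ε + G / (1 - H.β₁)) / (2 * H.α) := by
    rcases T with _ | T
    · simp [invStep]
    · have := h.sqrt_vh_div_le hβ₁ hlam hβ₂ hG hg T (by omega)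
      rw [invStep]
      gcongr
  have hc0 : 0 ≤ invStep H vh T :=
    (monotone_nat_of_le_succ (h.invStep_mono hα hβ₁ hlam hε)) (Nat.zero_le T)
  have e1 : invStep H vh T * (B ^ 2 - x T ^ 2) ≤
      √T * (H.ε + G / (1 - H.β₁)) / (2 * H.α) * B ^ 2 :=
    (mul_le_mul_of_nonneg_left (sub_le_self _ (sq_nonneg (x T))) hc0).trans (by gcongr)
  have e2 : √T * ((B ^ 2 * H.ε / (2 * H.α) + G * B) / (1 - H.β₁) * ∑ t ∈ range T, H.lam ^ t) ≤
      √T * ((B ^ 2 * H.ε / (2 * H.α) + G * B) / (1 - H.β₁) * (1 / (1 - H.lam))) := by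
    gcongr
    exact sum_pow_le hlam.1.le hlam.2 T
  have e3 : H.α * G ^ 2 / (2 * H.ε * (1 - H.β₁)) * ∑ t ∈ range T, 1 / √(t + 1 : ℕ) ≤
      H.α * G ^ 2 / (2 * H.ε * (1 - H.β₁)) * (2 * √T) := by
    gcongr
    exact sum_one_div_sqrt_le T
  calc ∑ t ∈ range T, g t * x t
      ≤ ∑ t ∈ range T, (invStep H vh (t + 1) * (x t ^ 2 - x (t + 1) ^ 2)
        + √T * ((B ^ 2 * H.ε / (2 * H.α) + G * B) / (1 - H.β₁) * H.lam ^ t)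
        + H.α * G ^ 2 / (2 * H.ε * (1 - H.β₁)) * (1 / √(t + 1 : ℕ))) :=
        sum_le_sum fun t ht =>
          h.mul_le hα hβ₁ hlam hε hG hB hg hx (mem_range.1 ht)
    _ ≤ √T * (H.ε + G / (1 - H.β₁)) / (2 * H.α) * B ^ 2
        + √T * ((B ^ 2 * H.ε / (2 * H.α) + G * B) / (1 - H.β₁) * (1 / (1 - H.lam)))
        + H.α * G ^ 2 / (2 * H.ε * (1 - H.β₁)) * (2 * √T) := by
        rw [sum_add_distrib, sum_add_distrib, ← mul_sum, ← mul_sum, ← mul_sum]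
        have := tel T le_rfl
        linarith
    _ = regretConst H G B * √T := by
        rw [regretConst]
        field_simp

end AdaptiveStep

/-! ### Linearization of convex losses. -/

open scoped InnerProductSpace

theorem sum_Icc_one_eq_sum_range {M : Type*} [AddCommMonoid M] (f : ℕ → M) (T : ℕ) :
    ∑ t ∈ Icc 1 T, f t = ∑ t ∈ range T, f (t + 1) := by
  induction T with
  | zero => simp
  | succ T ih => rw [sum_Icc_succ_top (by omega), ih, sum_range_succ]

theorem sub_le_inner_gradient {E : Type*} [NormedAddCommGroup E] [InnerProductSpace ℝ E]
    [CompleteSpace E] {f : E → ℝ} (hf : ConvexOn ℝ Set.univ f) {x : E}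
    (hd : DifferentiableAt ℝ f x) (y : E) : f x - f y ≤ ⟪gradient f x, x - y⟫_ℝ := by
  have hc : ConvexOn ℝ Set.univ (f ∘ AffineMap.lineMap (k := ℝ) x y) :=
    hf.comp_affineMap (AffineMap.lineMap x y)
  have hg : HasFDerivAt f (InnerProductSpace.toDual ℝ E (gradient f x)) x :=
    hd.hasGradientAt.hasFDerivAt
  have hder : HasDerivAt (f ∘ AffineMap.lineMap (k := ℝ) x y) ⟪gradient f x, y - x⟫_ℝ 0 := by
    have h := HasFDerivAt.comp_hasDerivAt_of_eq (𝕜 := ℝ) (0 : ℝ) hg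
      (AffineMap.hasDerivAt_lineMap (a := x) (b := y) (x := (0 : ℝ))) (by simp)
    simpa using h
  have := hc.le_slope_of_hasDerivAt (Set.mem_univ _) (Set.mem_univ _) one_pos hder
  simp only [slope_def_field, Function.comp, AffineMap.lineMap_apply_zero,
    AffineMap.lineMap_apply_one, sub_zero, div_one] at this
  have e : ⟪gradient f x, x - y⟫_ℝ = - ⟪gradient f x, y - x⟫_ℝ := by
    rw [← inner_neg_right, neg_sub]
  linarith

/-- The effective exploration rate: when `γ = 0` the weights never move, so that the sampling is
uniform. -/
noncomputable def explore (γ : ℝ) : ℝ := if γ = 0 then 1 else γ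

theorem explore_pos {γ : ℝ} (hγ : 0 ≤ γ) : 0 < explore γ := by
  rw [explore]
  split_ifs with h
  · exact one_pos
  · exact lt_of_le_of_ne hγ (Ne.symm h)

/-! ### The random run: bounded unbiased estimates, the law of the batches, and the expected regret.
-/

section Run

variable {d n : ℕ} {I : Setup d n} {H : HyperParams}

theorem state_w_pos (J : ℕ → Finset (Fin n)) (t : ℕ) (i : Fin n) : 0 < (I.state H J t).w i := by
  induction t with
  | zero => exact one_pos
  | succ t ih =>
    simp only [Setup.state, Setup.step, Setup.newWeight]
    split_ifs
    · exact ih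
    · positivity

theorem state_w_eq_one (hγ : H.γ = 0) (J : ℕ → Finset (Fin n)) (t : ℕ) (i : Fin n) :
    (I.state H J t).w i = 1 := by
  induction t with
  | zero => rfl
  | succ t ih => simp [Setup.state, Setup.step, Setup.newWeight, hγ, ih]

theorem prob_spec (hK : 1 ≤ I.K) (hKn : I.K < n) (hγ : 0 ≤ H.γ ∧ H.γ < 1)
    (J : ℕ → Finset (Fin n)) (t : ℕ) :
    IsSelVector I.K (I.prob H (I.state H J t)) ∧
      ∀ i, I.K * explore H.γ / n ≤ I.prob H (I.state H J t) i := by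
  have h := selProb_spec hK hKn hγ (state_w_pos (I := I) (H := H) J t)
  refine ⟨h.1, fun i => ?_⟩
  rw [explore]
  split_ifs with h0
  · rw [Setup.prob, h0, selProb_of_const hK hKn (state_w_eq_one h0 J t), mul_one]
  · exact h.2 i

theorem prob_pos (hK : 1 ≤ I.K) (hKn : I.K < n) (hγ : 0 ≤ H.γ ∧ H.γ < 1)
    (J : ℕ → Finset (Fin n)) (t : ℕ) (i : Fin n) : 0 < I.prob H (I.state H J t) i := by
  refine lt_of_lt_of_le ?_ ((prob_spec hK hKn hγ J t).2 i)
  have h1 : (0 : ℝ) < I.K := by exact_mod_cast hK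
  have h2 : (0 : ℝ) < n := by exact_mod_cast (by omega : 0 < n)
  have := explore_pos hγ.1
  positivity

/-- The importance weight `1 / (n * p_j / K)` is at most `1 / explore γ`, and the batch size `K`
cancels the averaging factor. -/
theorem norm_gradEst_le (hK : 1 ≤ I.K) (hKn : I.K < n) (hγ : 0 ≤ H.γ ∧ H.γ < 1) {L : ℝ}
    (J : ℕ → Finset (Fin n)) (t : ℕ) {S : Finset (Fin n)} (hS : S.card = I.K)
    (hL : ∀ i, ‖gradient (I.loss i) (I.state H J t).θ‖ ≤ L) :
    ‖I.gradEst H (I.state H J t) S‖ ≤ L / explore H.γ := by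
  have h1 : (0 : ℝ) < I.K := by exact_mod_cast hK
  have h2 : (0 : ℝ) < n := by exact_mod_cast (by omega : 0 < n)
  have he := explore_pos hγ.1
  have hterm : ∀ j ∈ S, ‖(1 / (n * (I.prob H (I.state H J t) j / I.K))) •
      gradient (I.loss j) (I.state H J t).θ‖ ≤ L / explore H.γ := fun j _ => by
    have hp := (prob_spec hK hKn hγ J t).2 j
    have hp0 := prob_pos hK hKn hγ J t j
    have h3 : explore H.γ ≤ n * (I.prob H (I.state H J t) j / I.K) := by
      rw [div_le_iff₀ h2] at hp
      rw [mul_div_assoc', le_div_iff₀ h1]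
      linarith
    rw [norm_smul, Real.norm_of_nonneg (by positivity), div_mul_eq_mul_div, one_mul]
    have : 0 ≤ L := (norm_nonneg _).trans (hL j)
    gcongr
    exact hL j
  rw [Setup.gradEst, norm_smul, Real.norm_of_nonneg (by positivity)]
  calc _ ≤ 1 / (I.K : ℝ) * (I.K * (L / explore H.γ)) := by
        gcongr
        refine (norm_sum_le_of_le S hterm).trans_eq ?_
        rw [sum_const, hS, nsmul_eq_mul]
    _ = L / explore H.γ := by field_simp

-- After exchanging the sums, sample `j` is weighted by its marginal `p_j`, which cancels the
-- importance weight.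
theorem sum_mul_inner_gradEst (hK : 1 ≤ I.K) {s : State d n} (hp : ∀ i, 0 < I.prob H s i)
    {q : Finset (Fin n) → ℝ} (hq : IsBatchLaw I.K (I.prob H s) q) (x : Vec d) :
    ∑ J, q J * ⟪I.gradEst H s J, x⟫_ℝ =
      1 / (n : ℝ) * ∑ i, ⟪gradient (I.loss i) s.θ, x⟫_ℝ := by
  have h1 : (I.K : ℝ) ≠ 0 := by exact_mod_cast (by omega : I.K ≠ 0)
  have e : ∀ J, q J * ⟪I.gradEst H s J, x⟫_ℝ = ∑ j, (if j ∈ J then q J else 0) *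
      (1 / (n : ℝ) * ⟪gradient (I.loss j) s.θ, x⟫_ℝ / I.prob H s j) := fun J => by
    rw [Setup.gradEst, real_inner_smul_left, sum_inner]
    simp only [real_inner_smul_left, ite_mul, zero_mul, mul_sum]
    rw [sum_ite_mem, univ_inter]
    refine sum_congr rfl fun j _ => ?_
    have := (hp j).ne'
    field_simp
  rw [sum_congr rfl fun J _ => e J, sum_comm, mul_sum]
  refine sum_congr rfl fun j _ => ?_
  rw [← sum_mul, hq.marginal j, mul_div_cancel₀ _ (hp j).ne']

/-- Adaptedness: the state depends only on past batches. This lets the law factor over the last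
batch. -/
theorem state_congr {J J' : ℕ → Finset (Fin n)} {t : ℕ} (h : ∀ s ∈ Icc 1 t, J s = J' s) :
    I.state H J t = I.state H J' t := by
  induction t with
  | zero => rfl
  | succ t ih =>
    rw [Setup.state, Setup.state, ih fun s hs => h s (Icc_subset_Icc_right t.le_succ hs),
      h (t + 1) (by simp)]

theorem batches_snoc_of_mem {T : ℕ} (ω : Fin T → Finset (Fin n)) (S : Finset (Fin n)) {t : ℕ}
    (ht : t ∈ Icc 1 T) :
    batches (Fin.snoc (α := fun _ => Finset (Fin n)) ω S) t = batches ω t := by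
  obtain ⟨h1, h2⟩ := mem_Icc.1 ht
  have h : t - 1 < T := by omega
  rw [batches, batches, dif_pos (by omega), dif_pos h]
  exact Fin.snoc_castSucc (α := fun _ => Finset (Fin n)) S ω ⟨t - 1, h⟩

theorem batches_snoc_last {T : ℕ} (ω : Fin T → Finset (Fin n)) (S : Finset (Fin n)) :
    batches (Fin.snoc (α := fun _ => Finset (Fin n)) ω S) (T + 1) = S := by
  rw [batches, dif_pos (by omega)]
  exact Fin.snoc_last (α := fun _ => Finset (Fin n)) S ω

theorem state_snoc {T : ℕ} (ω : Fin T → Finset (Fin n)) (S : Finset (Fin n)) {t : ℕ}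
    (ht : t ≤ T) :
    I.state H (batches (Fin.snoc (α := fun _ => Finset (Fin n)) ω S)) t =
      I.state H (batches ω) t :=
  state_congr fun _ hs => batches_snoc_of_mem ω S (Icc_subset_Icc_right ht hs)

theorem law_snoc {T : ℕ} (ω : Fin T → Finset (Fin n)) (S : Finset (Fin n)) :
    I.law H (Fin.snoc (α := fun _ => Finset (Fin n)) ω S) =
      I.law H ω * depRound I.rule (I.prob H (I.state H (batches ω) T)) S := by
  rw [Setup.law, prod_Icc_succ_top (by omega), Setup.law, Nat.add_sub_cancel,
    batches_snoc_last, state_snoc ω S le_rfl]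
  congr 1
  refine prod_congr rfl fun t ht => ?_
  rw [batches_snoc_of_mem ω S ht, state_snoc ω S]
  have := mem_Icc.1 ht
  omega

/-- The tower property: condition on the first `T` batches and average over the last one. -/
theorem sum_law_succ {T : ℕ} (F : (Fin (T + 1) → Finset (Fin n)) → ℝ) :
    ∑ ω, I.law H ω * F ω = ∑ ω : Fin T → Finset (Fin n), I.law H ω *
      ∑ S, depRound I.rule (I.prob H (I.state H (batches ω) T)) S *
        F (Fin.snoc (α := fun _ => Finset (Fin n)) ω S) := by
  rw [← (Fin.snocEquiv fun _ => Finset (Fin n)).sum_comp, Fintype.sum_prod_type_right]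
  refine sum_congr rfl fun ω _ => ?_
  rw [mul_sum]
  refine sum_congr rfl fun S _ => ?_
  rw [← mul_assoc, ← law_snoc]
  rfl

theorem isBatchLaw_state (hK : 1 ≤ I.K) (hKn : I.K < n) (hγ : 0 ≤ H.γ ∧ H.γ < 1)
    (J : ℕ → Finset (Fin n)) (t : ℕ) :
    IsBatchLaw I.K (I.prob H (I.state H J t)) (depRound I.rule (I.prob H (I.state H J t))) :=
  isBatchLaw_depRound I.rule (prob_spec hK hKn hγ J t).1

theorem law_nonneg (hK : 1 ≤ I.K) (hKn : I.K < n) (hγ : 0 ≤ H.γ ∧ H.γ < 1) {T : ℕ}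
    (ω : Fin T → Finset (Fin n)) : 0 ≤ I.law H ω :=
  prod_nonneg fun _ _ => (isBatchLaw_state hK hKn hγ _ _).nonneg _

theorem sum_law (hK : 1 ≤ I.K) (hKn : I.K < n) (hγ : 0 ≤ H.γ ∧ H.γ < 1) (T : ℕ) :
    ∑ ω : Fin T → Finset (Fin n), I.law H ω = 1 := by
  induction T with
  | zero => simp [Setup.law]
  | succ T ih =>
    have h := sum_law_succ (I := I) (H := H) (T := T) fun _ => 1
    simp only [mul_one, (isBatchLaw_state hK hKn hγ _ _).sum_eq, ih] at h
    exact h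

theorem card_batch_of_law_pos (hK : 1 ≤ I.K) (hKn : I.K < n) (hγ : 0 ≤ H.γ ∧ H.γ < 1) {T : ℕ}
    {ω : Fin T → Finset (Fin n)} (hω : 0 < I.law H ω) {t : ℕ} (ht : t ∈ Icc 1 T) :
    (batches ω t).card = I.K :=
  (isBatchLaw_state hK hKn hγ _ _).card_eq _ (prod_ne_zero_iff.1 hω.ne' t ht)

/-- The expectation of a sum of increments with vanishing conditional expectation is zero. -/
theorem sum_law_mul_sum_eq_zero (hK : 1 ≤ I.K) (hKn : I.K < n) (hγ : 0 ≤ H.γ ∧ H.γ < 1)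
    (Y : State d n → Finset (Fin n) → ℝ)
    (hY : ∀ J t, ∑ S, depRound I.rule (I.prob H (I.state H J t)) S * Y (I.state H J t) S = 0)
    (T : ℕ) :
    ∑ ω : Fin T → Finset (Fin n), I.law H ω *
      ∑ t ∈ range T, Y (I.state H (batches ω) t) (batches ω (t + 1)) = 0 := by
  induction T with
  | zero => simp
  | succ T ih =>
    rw [sum_law_succ]
    refine Eq.trans (sum_congr rfl fun ω _ => ?_) ih
    congr 1
    have e : ∀ S, ∑ t ∈ range (T + 1),
        Y (I.state H (batches (Fin.snoc (α := fun _ => Finset (Fin n)) ω S)) t)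
          (batches (Fin.snoc (α := fun _ => Finset (Fin n)) ω S) (t + 1)) =
        (∑ t ∈ range T, Y (I.state H (batches ω) t) (batches ω (t + 1))) +
          Y (I.state H (batches ω) T) S := fun S => by
      rw [sum_range_succ, state_snoc ω S le_rfl, batches_snoc_last]
      congr 1
      refine sum_congr rfl fun t ht => ?_
      have := mem_range.1 ht
      rw [state_snoc ω S this.le, batches_snoc_of_mem ω S (by simp; omega)]
    simp only [e, mul_add, sum_add_distrib, hY, ← sum_mul,
      (isBatchLaw_state hK hKn hγ _ _).sum_eq, one_mul, add_zero]

/-- State `t` holds the iterate `θ_{t+1}`, so index `t` of the gradient and displacement belongs to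
iteration `t + 1`. -/
theorem isCoordRun_state (J : ℕ → Finset (Fin n)) (θ : Vec d) (u : Fin d) :
    IsCoordRun H (fun t => I.gradEst H (I.state H J t) (J (t + 1)) u)
      (fun t => (I.state H J t).m u) (fun t => (I.state H J t).v u)
      (fun t => (I.state H J t).vhat u) (fun t => (I.state H J t).θ u - θ u) where
  m_zero := rfl
  v_zero := rfl
  m_succ _ := rfl
  v_succ _ := rfl
  vh_succ _ := rfl
  x_succ t := by
    simp only [Setup.state, Setup.step]
    ring

/-- Each coordinate is bounded by the norm, so the one-dimensional bound applies `d` times with the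
same constants; this is the source of the factor `d`. -/
theorem sum_inner_gradEst_le {G B : ℝ} {T : ℕ} (hα : 0 < H.α)
    (hβ₁ : 0 ≤ H.β₁ ∧ H.β₁ < 1) (hlam : 0 < H.lam ∧ H.lam < 1) (hβ₂ : 0 ≤ H.β₂ ∧ H.β₂ < 1)
    (hε : 0 < H.ε) (hG : 0 ≤ G) (hB : 0 ≤ B) (J : ℕ → Finset (Fin n)) (θ : Vec d)
    (hg : ∀ t < T, ‖I.gradEst H (I.state H J t) (J (t + 1))‖ ≤ G)
    (hx : ∀ t < T, ‖(I.state H J t).θ - θ‖ ≤ B) :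
    ∑ t ∈ range T, ⟪I.gradEst H (I.state H J t) (J (t + 1)), (I.state H J t).θ - θ⟫_ℝ ≤
      regretConst H G B * (d * √T) := by
  have e : ∀ a b : Vec d, ⟪a, b⟫_ℝ = ∑ u, a u * b u := fun a b => by
    rw [PiLp.inner_apply]
    exact sum_congr rfl fun u _ => by simp [mul_comm]
  simp only [e]
  rw [sum_comm]
  calc _ ≤ ∑ _u : Fin d, regretConst H G B * √T := by
        refine sum_le_sum fun u _ => ?_
        refine (isCoordRun_state (I := I) (H := H) J θ u).regret_le hα hβ₁ hlam hβ₂ hε hG hB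
          (fun t ht => ?_) (fun t ht => ?_)
        · exact (PiLp.norm_apply_le (I.gradEst H (I.state H J t) (J (t + 1))) u).trans (hg t ht)
        · exact (PiLp.norm_apply_le ((I.state H J t).θ - θ) u).trans (hx t ht)
    _ = _ := by simp; ring

theorem objective_sub_le (hconv : ∀ i, ConvexOn ℝ Set.univ (I.loss i))
    (hdiff : ∀ i, Differentiable ℝ (I.loss i)) (x y : Vec d) :
    I.objective x - I.objective y ≤
      1 / (n : ℝ) * ∑ i, ⟪gradient (I.loss i) x, x - y⟫_ℝ := by
  rw [Setup.objective, Setup.objective, ← mul_sub, ← sum_sub_distrib]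
  gcongr with i
  exact sub_le_inner_gradient (hconv i) (hdiff i x) y

theorem regret_le {L D : ℝ} {T : ℕ} {θ : Vec d} (hα : 0 < H.α)
    (hβ₁ : 0 ≤ H.β₁ ∧ H.β₁ < 1) (hlam : 0 < H.lam ∧ H.lam < 1) (hβ₂ : 0 ≤ H.β₂ ∧ H.β₂ < 1)
    (hε : 0 < H.ε) (hγ : 0 ≤ H.γ ∧ H.γ < 1) (hL : 0 ≤ L) (hD : 0 ≤ D)
    (hK : 1 ≤ I.K) (hKn : I.K < n) (hconv : ∀ i, ConvexOn ℝ Set.univ (I.loss i))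
    (hdiff : ∀ i, Differentiable ℝ (I.loss i)) (hmin : IsMinOn I.objective Set.univ θ)
    (hθ : ‖I.θ₁ - θ‖ ≤ D) (hgrad : I.BoundedGradient H T L) (hparam : I.BoundedParameter H T D) :
    I.regret H T ≤ regretConst H (L / explore H.γ) (2 * D) * (d * √T) := by
  have hinf : ⨅ x, I.objective x = I.objective θ :=
    le_antisymm (ciInf_le ⟨I.objective θ, by rintro _ ⟨x, rfl⟩; exact hmin (Set.mem_univ x)⟩ θ)
      (le_ciInf fun x => hmin (Set.mem_univ x))
  set C := regretConst H (L / explore H.γ) (2 * D)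
  -- The martingale increment: the true gradient minus its estimate, tested against the
  -- displacement.
  let Y : State d n → Finset (Fin n) → ℝ := fun s S =>
    1 / (n : ℝ) * (∑ i, ⟪gradient (I.loss i) s.θ, s.θ - θ⟫_ℝ) - ⟪I.gradEst H s S, s.θ - θ⟫_ℝ
  have hY : ∀ J t, ∑ S, depRound I.rule (I.prob H (I.state H J t)) S *
      Y (I.state H J t) S = 0 := fun J t => by
    have hq := isBatchLaw_state (I := I) (H := H) hK hKn hγ J t
    simp only [Y, mul_sub, sum_sub_distrib, ← sum_mul, hq.sum_eq, one_mul]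
    rw [sum_mul_inner_gradEst hK (prob_pos hK hKn hγ J t) hq, sub_self]
  have key : ∀ ω : Fin T → Finset (Fin n), I.law H ω *
      (∑ t ∈ Icc 1 T, I.objective (I.iterate H (batches ω) t) - T * ⨅ x, I.objective x) ≤
      I.law H ω * (∑ t ∈ range T, Y (I.state H (batches ω) t) (batches ω (t + 1)))
        + I.law H ω * (C * (d * √T)) := fun ω => by
    -- The boundedness hypotheses hold only almost surely; outcomes of probability zero contribute
    -- nothing.
    rcases (law_nonneg hK hKn hγ ω).eq_or_lt with h0 | hpos
    · simp [← h0]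
    rw [← mul_add]
    refine mul_le_mul_of_nonneg_left ?_ hpos.le
    rw [sum_Icc_one_eq_sum_range, hinf]
    have hmem : ∀ t < T, t + 1 ∈ Icc 1 T := fun t ht => by simp; omega
    have hg : ∀ t < T, ‖I.gradEst H (I.state H (batches ω) t) (batches ω (t + 1))‖ ≤
        L / explore H.γ := fun t ht =>
      norm_gradEst_le hK hKn hγ _ t (card_batch_of_law_pos hK hKn hγ hpos (hmem t ht))
        fun i => hgrad ω hpos i (t + 1) (hmem t ht)
    -- The distance `2 * D` to the minimizer comes from passing through `θ₁`.
    have hx : ∀ t < T, ‖(I.state H (batches ω) t).θ - θ‖ ≤ 2 * D := fun t ht => by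
      have h1 : ‖(I.state H (batches ω) t).θ - I.θ₁‖ ≤ D :=
        hparam ω hpos (t + 1) (hmem t ht) 1 (hmem 0 (by omega))
      have h2 := norm_sub_le_norm_sub_add_norm_sub (I.state H (batches ω) t).θ I.θ₁ θ
      linarith
    have hsum := sum_inner_gradEst_le (I := I) hα hβ₁ hlam hβ₂ hε
      (div_nonneg hL (explore_pos hγ.1).le) (by linarith) (batches ω) θ hg hx
    calc _ = ∑ t ∈ range T,
          (I.objective (I.state H (batches ω) t).θ - I.objective θ) := by
          rw [sum_sub_distrib, sum_const, card_range, nsmul_eq_mul]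
          rfl
      _ ≤ ∑ t ∈ range T, (Y (I.state H (batches ω) t) (batches ω (t + 1)) +
          ⟪I.gradEst H (I.state H (batches ω) t) (batches ω (t + 1)),
            (I.state H (batches ω) t).θ - θ⟫_ℝ) := by
          refine sum_le_sum fun t _ => ?_
          simpa only [Y, sub_add_cancel] using objective_sub_le hconv hdiff _ θ
      _ ≤ _ := by
          rw [sum_add_distrib]
          gcongr
  calc I.regret H T ≤ _ := sum_le_sum fun ω _ => key ω
    _ = C * (d * √T) := by
      rw [sum_add_distrib, sum_law_mul_sum_eq_zero hK hKn hγ Y hY, ← sum_mul, sum_law hK hKn hγ]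
      ring

end Run

end AdamCB

theorem mainTheorem4 (H : AdamCB.HyperParams) (L D : ℝ)
    (hα : 0 < H.α) (hβ₁ : 0 ≤ H.β₁ ∧ H.β₁ < 1) (hlam : 0 < H.lam ∧ H.lam < 1)
    (hβ₂ : 0 ≤ H.β₂ ∧ H.β₂ < 1) (hε : 0 < H.ε) (hγ : 0 ≤ H.γ ∧ H.γ < 1)
    (hL : 0 < L) (hD : 0 < D) :
    ∃ C : ℝ, 0 < C ∧ ∀ (d n : ℕ) (I : AdamCB.Setup d n) (T : ℕ) (θstar : AdamCB.Vec d),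
      1 ≤ I.K → I.K < n → 0 < I.pmin → 0 ≤ I.L₀ →
      (∀ i, ConvexOn ℝ Set.univ (I.loss i)) →
      (∀ i, Differentiable ℝ (I.loss i)) →
      IsMinOn I.objective Set.univ θstar →
      ‖I.θ₁ - θstar‖ ≤ D →
      I.BoundedGradient H T L →
      I.BoundedParameter H T D →
      I.regret H T ≤ C * (d * Real.sqrt T + Real.sqrt d / (n : ℝ) ^ (3 / 4 : ℝ) *
        ((T : ℝ) / I.K * Real.log ((n : ℝ) / I.K)) ^ (1 / 4 : ℝ)) := by
  have hb : 0 < 1 - H.β₁ := by linarith [hβ₁.2]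
  have hl : 0 < 1 - H.lam := by linarith [hlam.2]
  have he := AdamCB.explore_pos hγ.1
  have hC : 0 < AdamCB.regretConst H (L / AdamCB.explore H.γ) (2 * D) := by
    rw [AdamCB.regretConst]
    positivity
  refine ⟨_, hC, fun d n I T θstar hK hKn _ _ hconv hdiff hmin hθ hgrad hparam => ?_⟩
  -- The first summand already bounds the regret; the second is nonnegative because `K < n` makes
  -- the logarithm nonnegative.
  refine (AdamCB.regret_le hα hβ₁ hlam hβ₂ hε hγ hL.le hD.le hK hKn hconv hdiff hmin hθ hgrad
    hparam).trans (mul_le_mul_of_nonneg_left (le_add_of_nonneg_right ?_) hC.le)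
  have hlog : 0 ≤ Real.log ((n : ℝ) / I.K) := by
    refine Real.log_nonneg ((one_le_div (by exact_mod_cast hK)).2 (by exact_mod_cast hKn.le))
  positivity
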